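/- Let $k\ge 2$ and $m\ge 1$ be integers and consider the hierarchical normal model in which, independently for $i=1,\dots,m$, $$X_i\mid\theta_i\sim N_k(\theta_i,I),\qquad \theta_i\mid\beta,V\sim N_k(\beta,V),\qquad V=H^tDH,$$ with $H$ a $k\times k$ orthonormal matrix and $D=\operatorname{diag}(d_1,\dots,d_k)$, $d_1>d_2>\dots>d_k>0$. Let $\beta\sim N_k(0,A)$, where $A$ is a given positive semidefinite matrix, and independently let $(H,D)$ have the (possibly improper) prior $\pi(H,D)\,I_{[d_1>\dots>d_k>0]}\,dD\,dH$, where $dD=\prod_i dd_i$ and $dH$ is invariant Haar measure on the group of $k\times k$ orthonormal matrices. Let $0\le l\le 1$ and $a_1,a_2\in\mathbb R$, and suppose that there are constants $C_1,C_2>0$ such that for all $H$ and all $d_1>\dots>d_k>0$ $$\frac{C_1\,[\prod_{i<j}(d_i-d_j)]^{l}}{|I+D|^{a_2-a_1}\,|D|^{a_1}}\;\le\;\pi(H,D)\;\le\;\frac{C_2\,[\prod_{i<j}(d_i-d_j)]^{l}}{|I+D|^{a_2-a_1}\,|D|^{a_1}},$$ where $|\cdot|$ is the determinant. Then, for every data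 point $x=(x_1,\dots,x_m)\in(\mathbb R^k)^m$, the posterior distribution of $(\theta,\beta,H,D)$ given $X=x$ is proper (that is, the marginal density $$m(x)=\int f(x\mid\theta)\,\pi(\theta\mid\beta,H,D)\,\pi(H,D)\,I_{[d_1>\dots>d_k>0]}\,dD\,dH\,N_k(0,A)(d\beta)\,d\theta$$ satisfies $0<m(x)<\infty$, where $f(x\mid\theta)$ and $\pi(\theta\mid\beta,H,D)$ are the normal densities of the model) if and only if $$a_1<1\quad\text{and}\quad a_2>1-\frac m2+(k-1)l .$$ -/

import Mathlib

open MeasureTheory ProbabilityTheory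
open scoped ENNReal

noncomputable section

namespace HierNormal

/-- Euclidean `k`-space. -/
abbrev E (k : ℕ) : Type := EuclideanSpace ℝ (Fin k)

/-- The compact group `O(k)` of orthonormal `k × k` real matrices. -/
abbrev O (k : ℕ) : Type := Matrix.orthogonalGroup (Fin k) ℝ

/-- `O(k)` carries the Borel σ-algebra of its topology as a subspace of `ℝ^{k × k}`. -/
instance instMeasurableSpaceO (k : ℕ) : MeasurableSpace (O k) := borel (O k)

instance instBorelSpaceO (k : ℕ) : BorelSpace (O k) := ⟨rfl⟩

/-- The Lebesgue density at `y` of the normal law `N_k(μ, S)`, for `S` positive definite. -/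
def normalDensity {k : ℕ} (μ : E k) (S : Matrix (Fin k) (Fin k) ℝ) (y : E k) : ℝ :=
  (2 * Real.pi) ^ (-(k : ℝ) / 2) * S.det ^ (-(1 / 2) : ℝ) *
    Real.exp (-(1 / 2) * ((y - μ).ofLp ⬝ᵥ S⁻¹.mulVec (y - μ).ofLp))

/-- The hyper-covariance matrix `V = Hᵗ D H`, with `D = diag(d₁, …, d_k)`. -/
def hyperCov {k : ℕ} (H : O k) (d : Fin k → ℝ) : Matrix (Fin k) (Fin k) ℝ :=
  (H : Matrix (Fin k) (Fin k) ℝ).transpose * Matrix.diagonal d * (H : Matrix (Fin k) (Fin k) ℝ)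

/-- The range `d₁ > d₂ > ⋯ > d_k > 0` of the eigenvalues. -/
def spectra (k : ℕ) : Set (Fin k → ℝ) :=
  {d | StrictAnti d ∧ ∀ i, 0 < d i}

/-- `[∏_{i<j} (d_i - d_j)]^l / (|I + D|^{a₂ - a₁} |D|^{a₁})`. -/
def referenceDensity {k : ℕ} (a₁ a₂ l : ℝ) (d : Fin k → ℝ) : ℝ :=
  (∏ i, ∏ j ∈ Finset.Ioi i, (d i - d j)) ^ l /
    ((1 + Matrix.diagonal d).det ^ (a₂ - a₁) * (Matrix.diagonal d).det ^ a₁)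

/-- The condition on the prior density `π(H, D)` of `(H, D)` with respect to `dD dH` on
`d₁ > ⋯ > d_k > 0`: it lies between two positive multiples of the reference density. -/
def Condition1 {k : ℕ} (a₁ a₂ l : ℝ) (π : O k × (Fin k → ℝ) → ℝ) : Prop :=
  ∃ C₁ C₂ : ℝ, 0 < C₁ ∧ 0 < C₂ ∧ ∀ (H : O k), ∀ d ∈ spectra k,
    C₁ * referenceDensity a₁ a₂ l d ≤ π (H, d) ∧
      π (H, d) ≤ C₂ * referenceDensity a₁ a₂ l d

/-- The parameter space: `(θ, β, H, D)` with `θ = (θ₁, …, θ_m)`. -/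
abbrev Param (m k : ℕ) : Type := (Fin m → E k) × E k × O k × (Fin k → ℝ)

/-- The reference measure `dθ N_k(0, A)(dβ) dH I[d₁ > ⋯ > d_k > 0] dD`, where `dH` is `ν`. -/
def baseMeasure (m : ℕ) {k : ℕ} (A : Matrix (Fin k) (Fin k) ℝ) (ν : Measure (O k)) :
    Measure (Param m k) :=
  (volume : Measure (Fin m → E k)).prod
    ((multivariateGaussian 0 A).prod (ν.prod (volume.restrict (spectra k))))

/-- The joint density `f(x | θ) π(θ | β, H, D) π(H, D)` with respect to the reference measure,
where `X_i | θ_i ∼ N_k(θ_i, I)` and `θ_i | β, H, D ∼ N_k(β, V)`, `i = 1, …, m`, independently. -/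
def jointDensity {m k : ℕ} (π : O k × (Fin k → ℝ) → ℝ) (x : Fin m → E k) (q : Param m k) : ℝ :=
  (∏ i, normalDensity (q.1 i) 1 (x i)) *
    (∏ i, normalDensity q.2.1 (hyperCov q.2.2.1 q.2.2.2) (q.1 i)) * π q.2.2

/-- The marginal density `m(x)` of the data, possibly infinite. -/
def marginalDensity {m k : ℕ} (A : Matrix (Fin k) (Fin k) ℝ) (ν : Measure (O k))
    (π : O k × (Fin k → ℝ) → ℝ) (x : Fin m → E k) : ℝ≥0∞ :=
  ∫⁻ q, ENNReal.ofReal (jointDensity π x q) ∂(baseMeasure m A ν)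

/-- The formal posterior of `(θ, β, H, D)` given `X = x` by Bayes' formula: the joint density
divided by `m(x)`. -/
def posterior {m k : ℕ} (A : Matrix (Fin k) (Fin k) ℝ) (ν : Measure (O k))
    (π : O k × (Fin k → ℝ) → ℝ) (x : Fin m → E k) : Measure (Param m k) :=
  (marginalDensity A ν π x)⁻¹ •
    (baseMeasure m A ν).withDensity (fun q => ENNReal.ofReal (jointDensity π x q))

/-- The posterior exists (is proper) if Bayes' formula gives a probability measure. -/
def PosteriorProper {m k : ℕ} (A : Matrix (Fin k) (Fin k) ℝ) (ν : Measure (O k))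
    (π : O k × (Fin k → ℝ) → ℝ) (x : Fin m → E k) : Prop :=
  IsProbabilityMeasure (posterior A ν π x)

/-- Properness says exactly that `0 < m(x) < ∞`. -/
theorem posteriorProper_iff {m k : ℕ} (A : Matrix (Fin k) (Fin k) ℝ) (ν : Measure (O k))
    (π : O k × (Fin k → ℝ) → ℝ) (x : Fin m → E k) :
    PosteriorProper A ν π x ↔ 0 < marginalDensity A ν π x ∧ marginalDensity A ν π x < ∞ := by
  have key : posterior A ν π x Set.univ
      = (marginalDensity A ν π x)⁻¹ * marginalDensity A ν π x := by
    simp [posterior, marginalDensity]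
  constructor
  · intro h
    have h1 : posterior A ν π x Set.univ = 1 := h.measure_univ
    rw [key] at h1
    constructor
    · rw [pos_iff_ne_zero]
      intro h0
      simp [h0] at h1
    · rw [lt_top_iff_ne_top]
      intro h0
      simp [h0] at h1
  · rintro ⟨h0, h1⟩
    exact ⟨by rw [key, ENNReal.inv_mul_cancel h0.ne' h1.ne]⟩

end HierNormal

end

/-! Rotate by `H`: both normal layers split into independent coordinates, since `H` diagonalises `V`
and leaves `I` unchanged. Integrating out `θ` leaves the product over i and j of the N(0, 1 + d_j)
densities at the coordinates of H(x_i - β). As 1 + d_j ≥ 1 and `H` preserves lengths, this lies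
between c ∏ (1 + d_j)^(-m/2) exp(-½ ∑ |x_i - β|²) and c ∏ (1 + d_j)^(-m/2) (`le_likelihood`,
`likelihood_le`). Both bounds are free of `H`, and `β` enters only through a factor with positive
finite mean under its Gaussian prior. Since O(k) is compact, its Haar mass is finite. Hence
properness amounts to finiteness of the integral of `profile`, with c = m/2, over the ordered
eigenvalues; that integral is always positive.

The integrand is [∏ (d_i - d_j)]^l ∏ (1 + d_i)^(-(a₂ - a₁ + m/2)) d_i^(-a₁). Bounding the gap
product by ∏ (1 + d_i)^(k-1) dominates the integral by a product of one-dimensional ones, finite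
under the stated conditions (`lintegral_profile_lt_top`). Conversely, keep the eigenvalues in
separated intervals. Letting the smallest approach 0 forces a₁ < 1. Letting the largest run to
infinity makes the gap product at least of order d_1^(k-1), which forces the condition on a₂. -/

namespace HierNormal

/-! ### Integrals of separated products. -/

/-- Tonelli's theorem for a product of functions of the separate coordinates. -/
theorem lintegral_pi_prod {n : ℕ} {α : Type*} [MeasurableSpace α] (μ : Fin n → Measure α)
    [∀ i, SigmaFinite (μ i)] (f : Fin n → α → ℝ≥0∞) (hf : ∀ i, Measurable (f i)) :
    ∫⁻ y, ∏ i, f i (y i) ∂(Measure.pi μ) = ∏ i, ∫⁻ t, f i t ∂(μ i) := by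
  induction n with
  | zero => simp
  | succ n ih =>
    have h := (measurePreserving_piFinSuccAbove μ 0).symm
    rw [← h.lintegral_comp_emb (MeasurableEquiv.measurableEmbedding _)]
    simp only [Fin.prod_univ_succ, MeasurableEquiv.piFinSuccAbove_symm_apply, Fin.insertNthEquiv,
      Equiv.coe_fn_mk, Fin.insertNth_zero', Fin.cons_zero, Fin.cons_succ, Fin.zero_succAbove]
    rw [lintegral_prod_mul (f := f 0)
      (g := fun y : Fin n → α => ∏ i : Fin n, f i.succ (y i)) (hf 0).aemeasurable
      (Finset.measurable_fun_prod _ fun i _ =>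
        (hf i.succ).comp (measurable_pi_apply i)).aemeasurable]
    rw [ih (fun i => μ i.succ) (fun i => f i.succ) (fun i => hf _)]

theorem setLIntegral_pi_prod {n : ℕ} (s : Fin n → Set ℝ) (f : Fin n → ℝ → ℝ≥0∞)
    (hf : ∀ i, Measurable (f i)) :
    ∫⁻ y in Set.univ.pi s, ∏ i, f i (y i) = ∏ i, ∫⁻ t in s i, f i t := by
  rw [volume_pi, Measure.restrict_pi_pi, lintegral_pi_prod _ _ hf]

/-! ### One-dimensional integrals: behaviour at zero and at infinity. -/

/-- The one-dimensional weight `(1 + t)^{-e} t^{-a}`. -/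
noncomputable def weight (a e t : ℝ) : ℝ := (1 + t) ^ (-e) * t ^ (-a)

theorem measurable_weight (a e : ℝ) : Measurable (weight a e) := by
  unfold weight
  fun_prop

theorem weight_pos (a e : ℝ) {t : ℝ} (ht : 0 < t) : 0 < weight a e t := by
  unfold weight
  positivity

/-- The sum 1 + 2^s bounds the power for either sign of s, so later estimates need no case split;
applied to -s and inverted, it gives the lower bound too. -/
theorem one_add_rpow_le (s : ℝ) {t : ℝ} (h0 : 0 < t) (h1 : t ≤ 1) :
    (1 + t) ^ s ≤ 1 + 2 ^ s := by
  rcases le_total 0 s with hs | hs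
  · have : (1 + t) ^ s ≤ 2 ^ s := Real.rpow_le_rpow (by linarith) (by linarith) hs
    linarith
  · have : (1 + t) ^ s ≤ 1 := Real.rpow_le_one_of_one_le_of_nonpos (by linarith) hs
    have : (0 : ℝ) < 2 ^ s := by positivity
    linarith

theorem le_one_add_rpow (s : ℝ) {t : ℝ} (h0 : 0 < t) (h1 : t ≤ 1) :
    (1 + 2 ^ (-s))⁻¹ ≤ (1 + t) ^ s := by
  have h := one_add_rpow_le (-s) h0 h1
  rw [Real.rpow_neg (by linarith)] at h
  exact inv_le_of_inv_le₀ (by positivity) h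

/-- Inversion t ↦ 1/t carries the bounds on (0, 1] over to t ≥ 1. -/
theorem one_add_rpow_eq (s : ℝ) {t : ℝ} (ht : 0 < t) :
    (1 + t) ^ s = t ^ s * (1 + t⁻¹) ^ s := by
  rw [← Real.mul_rpow ht.le (by positivity), mul_add, mul_inv_cancel₀ ht.ne']
  ring_nf

theorem lintegral_weight_lt_top {a e : ℝ} (ha : a < 1) (hae : 1 < a + e) :
    ∫⁻ t in Set.Ioi 0, ENNReal.ofReal (weight a e t) < ∞ := by
  suffices h : IntegrableOn (weight a e) (Set.Ioi 0) by
    have := h.2.lt_top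
    refine lt_of_le_of_lt (lintegral_mono fun t => ?_) this
    rw [← ofReal_norm]
    exact ENNReal.ofReal_le_ofReal (le_abs_self _)
  rw [← Set.Ioc_union_Ioi_eq_Ioi (zero_le_one' ℝ)]
  have hm := measurable_weight a e
  refine IntegrableOn.union ?_ ?_
  · have h1 : IntegrableOn (fun t : ℝ => (1 + 2 ^ (-e)) * t ^ (-a)) (Set.Ioc 0 1) :=
      ((intervalIntegrable_iff_integrableOn_Ioc_of_le zero_le_one).1
        (intervalIntegral.intervalIntegrable_rpow' (by linarith))).const_mul _
    refine Integrable.mono' h1 hm.aestronglyMeasurable ?_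
    filter_upwards [ae_restrict_mem measurableSet_Ioc] with t ht
    rw [Real.norm_of_nonneg (weight_pos a e ht.1).le]
    have := Real.rpow_nonneg ht.1.le (-a)
    exact mul_le_mul_of_nonneg_right (one_add_rpow_le _ ht.1 ht.2) this
  · have h1 : IntegrableOn (fun t : ℝ => (1 + 2 ^ (-e)) * t ^ (-e - a)) (Set.Ioi 1) :=
      (integrableOn_Ioi_rpow_of_lt (by linarith) one_pos).const_mul _
    refine Integrable.mono' h1 hm.aestronglyMeasurable ?_
    filter_upwards [ae_restrict_mem measurableSet_Ioi] with t ht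
    have ht : 1 < t := ht
    have ht0 : 0 < t := by linarith
    rw [Real.norm_of_nonneg (weight_pos a e ht0).le, weight, one_add_rpow_eq _ ht0, sub_eq_add_neg,
      Real.rpow_add ht0]
    have h2 := one_add_rpow_le (-e) (inv_pos.2 ht0) (inv_le_one_of_one_le₀ ht.le)
    have h3 := Real.rpow_nonneg ht0.le (-e)
    have h4 := Real.rpow_nonneg ht0.le (-a)
    nlinarith [mul_le_mul_of_nonneg_left h2 (mul_nonneg h3 h4)]

theorem setLIntegral_eq_top_of_le {f g : ℝ → ℝ} {s : Set ℝ} (hs : MeasurableSet s) {c : ℝ}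
    (hc : 0 < c) (hf : Measurable f) (hf0 : ∀ t ∈ s, 0 ≤ f t) (hfi : ¬ IntegrableOn f s)
    (h : ∀ t ∈ s, c * f t ≤ g t) :
    ∫⁻ t in s, ENNReal.ofReal (g t) = ∞ := by
  have h1 : ∫⁻ t in s, ENNReal.ofReal (f t) = ∞ := by
    by_contra hne
    refine hfi ⟨hf.aestronglyMeasurable, ?_⟩
    rw [hasFiniteIntegral_iff_ofReal ((ae_restrict_iff' hs).2 (.of_forall hf0))]
    exact lt_top_iff_ne_top.2 hne
  have h2 : ∫⁻ t in s, ENNReal.ofReal c * ENNReal.ofReal (f t) = ∞ := by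
    rw [lintegral_const_mul _ hf.ennreal_ofReal, h1, ENNReal.mul_top (by simpa using hc)]
  rw [eq_top_iff, ← h2]
  refine setLIntegral_mono' hs fun t ht => ?_
  rw [← ENNReal.ofReal_mul hc.le]
  exact ENNReal.ofReal_le_ofReal (h t ht)

theorem lintegral_weight_near_zero {a e : ℝ} (ha : 1 ≤ a) :
    ∫⁻ t in Set.Ioo 0 1, ENNReal.ofReal (weight a e t) = ∞ := by
  refine setLIntegral_eq_top_of_le measurableSet_Ioo (f := fun t => t ^ (-a))
    (c := (1 + 2 ^ e)⁻¹) (by positivity) (by fun_prop)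
    (fun t ht => Real.rpow_nonneg ht.1.le _) ?_ ?_
  · rw [intervalIntegral.integrableOn_Ioo_rpow_iff one_pos]
    linarith
  · intro t ht
    have := le_one_add_rpow (-e) ht.1 ht.2.le
    rw [neg_neg] at this
    exact mul_le_mul_of_nonneg_right this (Real.rpow_nonneg ht.1.le _)

/-- The factor (t/2)^b stands for the gap product when the top eigenvalue is t and the others stay
bounded. The integrand is of order t^(b - a - e) at infinity. -/
theorem lintegral_weight_at_infinity {a e b R : ℝ} (hR : 1 ≤ R) (h : a + e ≤ 1 + b) :
    ∫⁻ t in Set.Ioi R, ENNReal.ofReal ((t / 2) ^ b * weight a e t) = ∞ := by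
  refine setLIntegral_eq_top_of_le measurableSet_Ioi (f := fun t => t ^ (b + (-e + -a)))
    (c := (2 ^ b)⁻¹ * (1 + 2 ^ e)⁻¹) (by positivity) (by fun_prop)
    (fun t ht => Real.rpow_nonneg (by have : R < t := ht; linarith) _) ?_ ?_
  · rw [integrableOn_Ioi_rpow_iff (by linarith)]
    linarith
  · intro t ht
    have ht : R < t := ht
    have ht0 : 0 < t := by linarith
    have h2 := le_one_add_rpow (-e) (inv_pos.2 ht0) (inv_le_one_of_one_le₀ (by linarith))
    rw [neg_neg] at h2
    rw [weight, one_add_rpow_eq _ ht0, Real.rpow_add ht0, Real.rpow_add ht0,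
      Real.div_rpow ht0.le zero_le_two]
    calc (2 ^ b)⁻¹ * (1 + 2 ^ e)⁻¹ * (t ^ b * (t ^ (-e) * t ^ (-a)))
        = ((2 ^ b)⁻¹ * (t ^ b * (t ^ (-e) * t ^ (-a)))) * (1 + 2 ^ e)⁻¹ := by ring
      _ ≤ ((2 ^ b)⁻¹ * (t ^ b * (t ^ (-e) * t ^ (-a)))) * (1 + t⁻¹) ^ (-e) :=
          mul_le_mul_of_nonneg_left h2 (by positivity)
      _ = _ := by ring

/-! ### The integral over the ordered eigenvalues. -/

theorem measurableSet_spectra (k : ℕ) : MeasurableSet (spectra k) := by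
  have : spectra k = (⋂ i, ⋂ j, ⋂ _ : i < j, {d : Fin k → ℝ | d j < d i}) ∩
      ⋂ i, {d : Fin k → ℝ | 0 < d i} := by
    ext d
    simp [spectra, StrictAnti]
  rw [this]
  refine MeasurableSet.inter (.iInter fun i => .iInter fun j => .iInter fun _ => ?_)
    (.iInter fun i => ?_)
  · exact measurableSet_lt (measurable_pi_apply j) (measurable_pi_apply i)
  · exact measurableSet_lt measurable_const (measurable_pi_apply i)

/-- The Vandermonde-type product `∏_{i<j} (d_i - d_j)`. -/
noncomputable def gapProd {k : ℕ} (d : Fin k → ℝ) : ℝ := ∏ i, ∏ j ∈ Finset.Ioi i, (d i - d j)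

theorem gapProd_pos {k : ℕ} {d : Fin k → ℝ} (hd : d ∈ spectra k) : 0 < gapProd d :=
  Finset.prod_pos fun _ _ => Finset.prod_pos fun _ hj => sub_pos.2 (hd.1 (Finset.mem_Ioi.1 hj))

/-- Each gap d_i - d_j is below 1 + d_i, and at most k indices follow i. The bound is lossy for the
lower eigenvalues but exact in order for the top one, which alone decides convergence at infinity.
-/
theorem gapProd_le {k : ℕ} {d : Fin (k + 1) → ℝ} (hd : d ∈ spectra (k + 1)) :
    gapProd d ≤ ∏ i, (1 + d i) ^ k := by
  refine Finset.prod_le_prod (fun i _ => Finset.prod_nonneg fun j hj =>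
    (sub_pos.2 (hd.1 (Finset.mem_Ioi.1 hj))).le) fun i _ => ?_
  have hi := hd.2 i
  calc ∏ j ∈ Finset.Ioi i, (d i - d j) ≤ ∏ _j ∈ Finset.Ioi i, (1 + d i) :=
        Finset.prod_le_prod (fun j hj => (sub_pos.2 (hd.1 (Finset.mem_Ioi.1 hj))).le)
          fun j _ => by linarith [hd.2 j]
    _ = (1 + d i) ^ (Finset.Ioi i).card := Finset.prod_const _
    _ ≤ (1 + d i) ^ k := by
        refine pow_le_pow_right₀ (by linarith) ?_
        rw [Fin.card_Ioi]
        omega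

/-- The prior reference density times the factor `|I + D|^{-c}` contributed by the data. -/
noncomputable def profile {k : ℕ} (a₁ a₂ l c : ℝ) (d : Fin k → ℝ) : ℝ :=
  referenceDensity a₁ a₂ l d * ∏ i, (1 + d i) ^ (-c)

theorem referenceDensity_eq {k : ℕ} (a₁ a₂ l : ℝ) (d : Fin k → ℝ) :
    referenceDensity a₁ a₂ l d =
      gapProd d ^ l / ((∏ i, (1 + d i)) ^ (a₂ - a₁) * (∏ i, d i) ^ a₁) := by
  rw [referenceDensity, ← Matrix.diagonal_one, Matrix.diagonal_add, Matrix.det_diagonal,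
    Matrix.det_diagonal, gapProd]

theorem measurable_referenceDensity {k : ℕ} (a₁ a₂ l : ℝ) :
    Measurable (referenceDensity (k := k) a₁ a₂ l) := by
  simp_rw [funext (referenceDensity_eq (k := k) a₁ a₂ l), gapProd]
  fun_prop

theorem measurable_profile {k : ℕ} (a₁ a₂ l c : ℝ) :
    Measurable (profile (k := k) a₁ a₂ l c) := by
  have := measurable_referenceDensity (k := k) a₁ a₂ l
  unfold profile
  fun_prop

theorem referenceDensity_nonneg {k : ℕ} (a₁ a₂ l : ℝ) {d : Fin k → ℝ} (hd : d ∈ spectra k) :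
    0 ≤ referenceDensity a₁ a₂ l d := by
  rw [referenceDensity_eq]
  have h1 := (gapProd_pos hd).le
  have h2 : 0 ≤ ∏ i, (1 + d i) := Finset.prod_nonneg fun i _ => by linarith [hd.2 i]
  have h3 : 0 ≤ ∏ i, d i := Finset.prod_nonneg fun i _ => (hd.2 i).le
  positivity

/-- Apart from the gap product the integrand separates; each factor behaves like t^(-a₁) at 0 and
like t^(-(a₂ + c)) at infinity. -/
theorem profile_eq {k : ℕ} (a₁ a₂ l c : ℝ) {d : Fin k → ℝ} (hd : d ∈ spectra k) :
    profile a₁ a₂ l c d = gapProd d ^ l * ∏ i, weight a₁ (a₂ - a₁ + c) (d i) := by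
  have h2 : ∀ i, 0 < 1 + d i := fun i => by linarith [hd.2 i]
  rw [profile, referenceDensity_eq, ← Real.finsetProd_rpow _ _ fun i _ => (h2 i).le,
    ← Real.finsetProd_rpow _ _ fun i _ => (hd.2 i).le, ← Finset.prod_mul_distrib, div_eq_mul_inv,
    ← Finset.prod_inv_distrib, mul_assoc, ← Finset.prod_mul_distrib]
  congr 1
  refine Finset.prod_congr rfl fun i _ => ?_
  rw [weight, neg_add, Real.rpow_add (h2 i), Real.rpow_neg (h2 i).le (a₂ - a₁),
    Real.rpow_neg (hd.2 i).le, mul_inv]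
  ring

theorem lintegral_profile_lt_top {k : ℕ} {a₁ a₂ l c : ℝ} (hl : 0 ≤ l) (h1 : a₁ < 1)
    (h2 : 1 < a₂ + c - k * l) :
    ∫⁻ d in spectra (k + 1), ENNReal.ofReal (profile a₁ a₂ l c d) < ∞ := by
  calc ∫⁻ d in spectra (k + 1), ENNReal.ofReal (profile a₁ a₂ l c d)
      ≤ ∫⁻ d in spectra (k + 1), ∏ i, ENNReal.ofReal (weight a₁ (a₂ - a₁ + c - k * l) (d i)) := by
        refine setLIntegral_mono' (measurableSet_spectra _) fun d hd => ?_
        have hp : ∀ i, 0 < 1 + d i := fun i => by linarith [hd.2 i]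
        rw [← ENNReal.ofReal_prod_of_nonneg fun i _ => (weight_pos _ _ (hd.2 i)).le,
          profile_eq _ _ _ _ hd]
        refine ENNReal.ofReal_le_ofReal ?_
        have hg := Real.rpow_le_rpow (gapProd_pos hd).le (gapProd_le hd) hl
        refine (mul_le_mul_of_nonneg_right hg
          (Finset.prod_nonneg fun i _ => (weight_pos _ _ (hd.2 i)).le)).trans_eq ?_
        rw [← Real.finsetProd_rpow _ _ fun i _ => (pow_pos (hp i) _).le,
          ← Finset.prod_mul_distrib]
        refine Finset.prod_congr rfl fun i _ => ?_
        rw [weight, weight, ← mul_assoc, ← Real.rpow_natCast, ← Real.rpow_mul (hp i).le,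
          ← Real.rpow_add (hp i)]
        ring_nf
    _ ≤ ∫⁻ d in Set.univ.pi fun _ : Fin (k + 1) => Set.Ioi (0 : ℝ),
          ∏ i, ENNReal.ofReal (weight a₁ (a₂ - a₁ + c - k * l) (d i)) :=
        lintegral_mono_set fun d hd i _ => hd.2 i
    _ = ∏ _i : Fin (k + 1), ∫⁻ t in Set.Ioi 0,
          ENNReal.ofReal (weight a₁ (a₂ - a₁ + c - k * l) t) :=
        setLIntegral_pi_prod _ _ fun _ => (measurable_weight _ _).ennreal_ofReal
    _ < ∞ := ENNReal.prod_lt_top fun i _ => lintegral_weight_lt_top h1 (by linarith)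

/-- On a box inside the ordered cone the ordering constraint disappears, and a separated lower bound
for the gap product makes the integral factor. One infinite factor, with the others nonzero, then
gives divergence. -/
theorem prod_setLIntegral_le_lintegral_profile {k : ℕ} {a₁ a₂ l c : ℝ} (hl : 0 ≤ l)
    (s : Fin k → Set ℝ) (hs : ∀ i, MeasurableSet (s i)) (g : Fin k → ℝ → ℝ)
    (hg : ∀ i, Measurable (g i)) (hg0 : ∀ i, ∀ t ∈ s i, 0 ≤ g i t)
    (hsub : Set.univ.pi s ⊆ spectra k)
    (hgap : ∀ d ∈ Set.univ.pi s, ∏ i, g i (d i) ≤ gapProd d) :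
    ∏ i, ∫⁻ t in s i, ENNReal.ofReal (g i t ^ l * weight a₁ (a₂ - a₁ + c) t) ≤
      ∫⁻ d in spectra k, ENNReal.ofReal (profile a₁ a₂ l c d) := by
  have hm := measurable_weight a₁ (a₂ - a₁ + c)
  rw [← setLIntegral_pi_prod s _ fun i => by have := hg i; fun_prop]
  refine (setLIntegral_mono' (.univ_pi hs) fun d hd => ?_).trans (lintegral_mono_set hsub)
  have hd' := hsub hd
  have h0 : ∀ i, 0 ≤ g i (d i) := fun i => hg0 i _ (hd i trivial)
  rw [← ENNReal.ofReal_prod_of_nonneg fun i _ =>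
      mul_nonneg (Real.rpow_nonneg (h0 i) _) (weight_pos _ _ (hd'.2 i)).le, profile_eq _ _ _ _ hd',
    Finset.prod_mul_distrib, Real.finsetProd_rpow _ _ fun i _ => h0 i]
  refine ENNReal.ofReal_le_ofReal (mul_le_mul_of_nonneg_right ?_
    (Finset.prod_nonneg fun i _ => (weight_pos _ _ (hd'.2 i)).le))
  exact Real.rpow_le_rpow (Finset.prod_nonneg fun i _ => h0 i) (hgap d hd) hl

/-- The `i`-th side of a box inside `spectra (k + 1)` with sides at distance at least one. -/
def boxSide (k : ℕ) (i : Fin (k + 1)) : Set ℝ :=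
  Set.Ioo (2 * ((k : ℝ) - i)) (2 * ((k : ℝ) - i) + 1)

theorem boxSide_pos {k : ℕ} {i : Fin (k + 1)} {t : ℝ} (ht : t ∈ boxSide k i) : 0 < t := by
  have : (i : ℝ) ≤ k := by exact_mod_cast Nat.lt_succ_iff.1 i.2
  linarith [ht.1]

theorem boxSide_gap {k : ℕ} {i j : Fin (k + 1)} (hij : i < j) {s t : ℝ} (hs : s ∈ boxSide k i)
    (ht : t ∈ boxSide k j) : 1 ≤ s - t := by
  have : (i : ℝ) + 1 ≤ j := by exact_mod_cast hij
  linarith [hs.1, ht.2]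

theorem setLIntegral_weight_pos {a e : ℝ} {s : Set ℝ} (hs : ∀ t ∈ s, 0 < t)
    {g : ℝ → ℝ} (hg : Measurable g) (hg0 : ∀ t ∈ s, 0 < g t) (hv : 0 < volume s) :
    0 < ∫⁻ t in s, ENNReal.ofReal (g t * weight a e t) := by
  have hm := measurable_weight a e
  rw [setLIntegral_pos_iff (by fun_prop)]
  refine hv.trans_le (measure_mono fun t ht => ⟨?_, ht⟩)
  simpa using mul_pos (hg0 t ht) (weight_pos a e (hs t ht))

theorem volume_boxSide_pos (k : ℕ) (i : Fin (k + 1)) : 0 < volume (boxSide k i) := by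
  rw [boxSide, Real.volume_Ioo]
  simp

theorem prod_boxSide_le {k : ℕ} {a₁ a₂ l c : ℝ} (hl : 0 ≤ l) :
    ∏ i, ∫⁻ t in boxSide k i, ENNReal.ofReal (1 ^ l * weight a₁ (a₂ - a₁ + c) t) ≤
      ∫⁻ d in spectra (k + 1), ENNReal.ofReal (profile a₁ a₂ l c d) := by
  refine prod_setLIntegral_le_lintegral_profile hl (boxSide k) (fun _ => measurableSet_Ioo)
    (fun _ _ => 1) (fun _ => measurable_const) (fun _ _ _ => zero_le_one) (fun d hd => ?_)
    fun d hd => ?_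
  · exact ⟨fun i j hij => by linarith [boxSide_gap hij (hd i trivial) (hd j trivial)],
      fun i => boxSide_pos (hd i trivial)⟩
  · rw [Finset.prod_const_one]
    exact Finset.one_le_prod fun i _ => Finset.one_le_prod fun j hj =>
      boxSide_gap (Finset.mem_Ioi.1 hj) (hd i trivial) (hd j trivial)

theorem lintegral_profile_pos (k : ℕ) {a₁ a₂ l c : ℝ} (hl : 0 ≤ l) :
    0 < ∫⁻ d in spectra (k + 1), ENNReal.ofReal (profile a₁ a₂ l c d) := by
  refine lt_of_lt_of_le ?_ (prod_boxSide_le hl)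
  exact CanonicallyOrderedAdd.prod_pos.2 fun i _ => setLIntegral_weight_pos
    (fun t => boxSide_pos) measurable_const (fun _ _ => by simp) (volume_boxSide_pos k i)

theorem lintegral_profile_eq_top_of_one_le (k : ℕ) {a₁ a₂ l c : ℝ} (hl : 0 ≤ l) (h : 1 ≤ a₁) :
    ∫⁻ d in spectra (k + 1), ENNReal.ofReal (profile a₁ a₂ l c d) = ∞ := by
  refine eq_top_iff.2 (le_trans (eq_top_iff.1 ?_) (prod_boxSide_le hl))
  refine WithTop.prod_eq_top (Finset.mem_univ (Fin.last k)) ?_ fun i _ =>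
    (setLIntegral_weight_pos (fun t => boxSide_pos) measurable_const (fun _ _ => by simp)
      (volume_boxSide_pos k i)).ne'
  -- The last side is (0, 1), so the smallest eigenvalue reaches down to 0.
  simp only [boxSide, Fin.val_last, sub_self, mul_zero, zero_add, Real.one_rpow, one_mul]
  exact lintegral_weight_near_zero h

theorem lintegral_profile_eq_top_of_le (k : ℕ) {a₁ a₂ l c : ℝ} (hl : 0 ≤ l)
    (h : a₂ + c - k * l ≤ 1) :
    ∫⁻ d in spectra (k + 1), ENNReal.ofReal (profile a₁ a₂ l c d) = ∞ := by
  -- Only the top eigenvalue is released to infinity. The other sides lie below 2k + 1, so the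
  -- threshold 4(k + 1) makes every gap from the top at least half of it; there are k such gaps,
  -- hence (t/2)^k.
  set s : Fin (k + 1) → Set ℝ := Function.update (boxSide k) 0 (Set.Ioi (4 * (k + 1))) with hs
  set g : Fin (k + 1) → ℝ → ℝ := Function.update (fun _ _ => 1) 0 (fun t => (t / 2) ^ k) with hg
  have hs0 : s 0 = Set.Ioi (4 * ((k : ℝ) + 1)) := Function.update_self ..
  have hs1 : ∀ i, i ≠ 0 → s i = boxSide k i := fun i hi => Function.update_of_ne hi ..
  have hg0 : g 0 = fun t => (t / 2) ^ k := Function.update_self ..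
  have hg1 : ∀ i, i ≠ 0 → g i = fun _ => 1 := fun i hi => Function.update_of_ne hi ..
  have hk : (0 : ℝ) ≤ k := k.cast_nonneg
  have spos : ∀ i, ∀ t ∈ s i, 0 < t := by
    intro i t ht
    rcases eq_or_ne i 0 with rfl | hi
    · rw [hs0] at ht
      have : 4 * ((k : ℝ) + 1) < t := ht
      linarith
    · exact boxSide_pos (hs1 i hi ▸ ht)
  have gmeas : ∀ i, Measurable (g i) := by
    intro i
    rcases eq_or_ne i 0 with rfl | hi
    · rw [hg0]
      fun_prop
    · rw [hg1 i hi]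
      exact measurable_const
  have gpos : ∀ i, ∀ t ∈ s i, 0 < g i t := by
    intro i t ht
    have := spos i t ht
    rcases eq_or_ne i 0 with rfl | hi
    · rw [hg0]
      positivity
    · rw [hg1 i hi]
      exact one_pos
  have smeas : ∀ i, MeasurableSet (s i) := by
    intro i
    rcases eq_or_ne i 0 with rfl | hi
    · rw [hs0]
      exact measurableSet_Ioi
    · rw [hs1 i hi]
      exact measurableSet_Ioo
  have svol : ∀ i, 0 < volume (s i) := by
    intro i
    rcases eq_or_ne i 0 with rfl | hi
    · rw [hs0, Real.volume_Ioi]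
      exact ENNReal.zero_lt_top
    · rw [hs1 i hi]
      exact volume_boxSide_pos k i
  have gap0 : ∀ j, 0 < j → ∀ u ∈ s 0, ∀ v ∈ s j, u / 2 ≤ u - v := by
    intro j hj u hu v hv
    rw [hs0] at hu
    rw [hs1 j hj.ne'] at hv
    have h1 : 4 * ((k : ℝ) + 1) < u := hu
    have h2 : (0 : ℝ) ≤ (j : ℕ) := Nat.cast_nonneg _
    linarith [hv.2]
  have key := prod_setLIntegral_le_lintegral_profile (a₁ := a₁) (a₂ := a₂) (c := c) hl s smeas g
    gmeas (fun i t ht => (gpos i t ht).le) ?_ ?_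
  · refine eq_top_iff.2 (le_trans (eq_top_iff.1 ?_) key)
    refine WithTop.prod_eq_top (Finset.mem_univ 0) ?_ fun i _ =>
      (setLIntegral_weight_pos (spos i) ((gmeas i).pow_const l)
        (fun t ht => Real.rpow_pos_of_pos (gpos i t ht) l) (svol i)).ne'
    have := lintegral_weight_at_infinity (a := a₁) (e := a₂ - a₁ + c) (b := k * l)
      (R := 4 * ((k : ℝ) + 1)) (by linarith) (by linarith)
    rw [hs0, hg0]
    refine Eq.trans (setLIntegral_congr_fun measurableSet_Ioi fun t ht => ?_) this
    have h1 : 4 * ((k : ℝ) + 1) < t := ht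
    dsimp only
    rw [← Real.rpow_natCast, ← Real.rpow_mul (by linarith)]
  · refine fun d hd => ⟨fun i j hij => ?_, fun i => spos i _ (hd i trivial)⟩
    rcases eq_or_ne i 0 with rfl | hi
    · linarith [gap0 j hij _ (hd 0 trivial) _ (hd j trivial), spos 0 _ (hd 0 trivial)]
    · have hj : j ≠ 0 := (Fin.pos_of_ne_zero hi |>.trans hij).ne'
      linarith [boxSide_gap hij (hs1 i hi ▸ hd i trivial) (hs1 j hj ▸ hd j trivial)]
  · intro d hd
    refine Finset.prod_le_prod (fun i _ => (gpos i _ (hd i trivial)).le) fun i _ => ?_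
    rcases eq_or_ne i 0 with rfl | hi
    · have h0 := spos 0 _ (hd 0 trivial)
      have : ∏ _j ∈ Finset.Ioi (0 : Fin (k + 1)), (d 0 / 2) ≤
          ∏ j ∈ Finset.Ioi (0 : Fin (k + 1)), (d 0 - d j) :=
        Finset.prod_le_prod (fun _ _ => by linarith) fun j hj =>
          gap0 j (Finset.mem_Ioi.1 hj) _ (hd 0 trivial) _ (hd j trivial)
      rw [Finset.prod_const, Fin.card_Ioi] at this
      simpa [hg0] using this
    · rw [hg1 i hi]
      refine Finset.one_le_prod fun j hj => ?_
      have hij := Finset.mem_Ioi.1 hj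
      have hj : j ≠ 0 := (Fin.pos_of_ne_zero hi |>.trans hij).ne'
      exact boxSide_gap hij (hs1 i hi ▸ hd i trivial) (hs1 j hj ▸ hd j trivial)

/-! ### The orthogonal group and diagonalisation of the hyper-covariance. -/

/-- Closed, with entries in [-1, 1]. Compactness makes the Haar measure finite, so `H` contributes
only a constant. -/
theorem compactSpace_orthogonalGroup (k : ℕ) : CompactSpace (O k) := by
  refine isCompact_iff_compactSpace.1 (IsCompact.of_isClosed_subset
    (isCompact_univ_pi fun _ : Fin k => isCompact_univ_pi fun _ : Fin k =>
      isCompact_Icc (a := (-1 : ℝ)) (b := 1)) (isClosed_unitary (R := Matrix (Fin k) (Fin k) ℝ)) ?_)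
  intro U hU i _ j _
  exact abs_le.1 (entry_norm_bound_of_unitary hU i j)

theorem transpose_mul_self (k : ℕ) (H : O k) : H.1.transpose * H.1 = 1 :=
  Matrix.mem_unitaryGroup_iff'.1 H.2

theorem mul_transpose_self (k : ℕ) (H : O k) : H.1 * H.1.transpose = 1 :=
  Matrix.mem_unitaryGroup_iff.1 H.2

theorem det_transpose_mul_det {k : ℕ} (H : O k) : H.1.transpose.det * H.1.det = 1 := by
  rw [← Matrix.det_mul, transpose_mul_self, Matrix.det_one]

theorem det_hyperCov {k : ℕ} (H : O k) (d : Fin k → ℝ) : (hyperCov H d).det = ∏ i, d i := by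
  rw [hyperCov, Matrix.det_mul, Matrix.det_mul, Matrix.det_diagonal, mul_right_comm,
    det_transpose_mul_det, one_mul]

theorem hyperCov_mul {k : ℕ} (H : O k) (d d' : Fin k → ℝ) :
    hyperCov H d * hyperCov H d' = hyperCov H (d * d') := by
  rw [hyperCov, hyperCov, hyperCov]
  calc _ = H.1.transpose * Matrix.diagonal d * (H.1 * H.1.transpose) * Matrix.diagonal d' * H.1 := by
        simp only [Matrix.mul_assoc]
    _ = _ := by
        rw [mul_transpose_self, Matrix.mul_one, Matrix.mul_assoc H.1.transpose,
          Matrix.diagonal_mul_diagonal]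
        rfl

theorem hyperCov_one {k : ℕ} (H : O k) : hyperCov H 1 = 1 := by
  rw [hyperCov, Matrix.diagonal_one', Matrix.mul_one, transpose_mul_self]

theorem hyperCov_inv {k : ℕ} (H : O k) {d : Fin k → ℝ} (hd : ∀ i, 0 < d i) :
    (hyperCov H d)⁻¹ = hyperCov H d⁻¹ := by
  refine Matrix.inv_eq_right_inv ?_
  rw [hyperCov_mul, ← hyperCov_one H]
  congr 1
  ext i
  simp [(hd i).ne']

theorem dotProduct_hyperCov_mulVec {k : ℕ} (H : O k) (d y : Fin k → ℝ) :
    y ⬝ᵥ (hyperCov H d).mulVec y = ∑ j, d j * (H.1.mulVec y j) ^ 2 := by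
  rw [hyperCov, ← Matrix.mulVec_mulVec, ← Matrix.mulVec_mulVec, Matrix.dotProduct_mulVec,
    Matrix.vecMul_transpose, dotProduct]
  refine Finset.sum_congr rfl fun j _ => ?_
  rw [Matrix.mulVec_diagonal]
  ring

/-- The quadratic form identity at D = I; it is what removes `H` from the lower bound on the
likelihood. -/
theorem sum_sq_mulVec {k : ℕ} (H : O k) (y : Fin k → ℝ) :
    ∑ j, (H.1.mulVec y j) ^ 2 = ∑ j, y j ^ 2 := by
  have h := dotProduct_hyperCov_mulVec H 1 y
  rw [hyperCov_one, Matrix.one_mulVec, dotProduct] at h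
  simpa [pow_two] using h.symm

/-! ### Gaussian densities in the eigenbasis. -/

/-- The density of the centred normal law on the line with variance `v`. -/
noncomputable def centredPDF (v x : ℝ) : ℝ := (√(2 * Real.pi * v))⁻¹ * Real.exp (-x ^ 2 / (2 * v))

theorem centredPDF_nonneg (v x : ℝ) : 0 ≤ centredPDF v x := by
  unfold centredPDF
  positivity

theorem measurable_centredPDF : Measurable fun p : ℝ × ℝ => centredPDF p.1 p.2 := by
  unfold centredPDF
  fun_prop

theorem measurable_centredPDF_comp {α : Type*} [MeasurableSpace α] {f g : α → ℝ}
    (hf : Measurable f) (hg : Measurable g) : Measurable fun a => centredPDF (f a) (g a) :=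
  measurable_centredPDF.comp (hf.prodMk hg)

theorem centredPDF_eq {v : ℝ} (hv : 0 < v) (x : ℝ) :
    centredPDF v x = (√(2 * Real.pi))⁻¹ * v ^ (-(1 / 2) : ℝ) * Real.exp (-x ^ 2 / (2 * v)) := by
  rw [centredPDF, Real.sqrt_mul (by positivity), mul_inv, Real.rpow_neg hv.le, ← Real.sqrt_eq_rpow]

theorem lintegral_centredPDF_shift {v : ℝ} (hv : 0 < v) (a : ℝ) :
    ∫⁻ s, ENNReal.ofReal (centredPDF v (s - a)) = 1 := by
  have h := lintegral_gaussianPDFReal_eq_one a (v := ⟨v, hv.le⟩)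
    (fun h => hv.ne' (congrArg NNReal.toReal h))
  rw [← h]
  rfl

/-- The sum of independent centred normal variables of variances `1` and `d` has
variance `1 + d`. -/
theorem lintegral_centredPDF_mul {d : ℝ} (hd : 0 < d) (y : ℝ) :
    ∫⁻ s, ENNReal.ofReal (centredPDF 1 (y - s) * centredPDF d s) =
      ENNReal.ofReal (centredPDF (1 + d) y) := by
  have hd1 : 0 < 1 + d := by linarith
  -- Completing the square: given y, the variable s is normal with mean dy/(1 + d) and variance d/(1
  -- + d).
  have h : ∀ s, centredPDF 1 (y - s) * centredPDF d s =
      centredPDF (1 + d) y * centredPDF (d / (1 + d)) (s - d * y / (1 + d)) := by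
    intro s
    have e1 : ∀ a b c e : ℝ, (a * Real.exp b) * (c * Real.exp e) = a * c * Real.exp (b + e) := by
      intro a b c e
      rw [Real.exp_add]
      ring
    rw [centredPDF, centredPDF, centredPDF, centredPDF, e1, e1]
    congr 1
    · rw [← mul_inv, ← mul_inv, ← Real.sqrt_mul (by positivity), ← Real.sqrt_mul (by positivity)]
      congr 2
      field_simp
    · congr 1
      field_simp
      ring
  simp_rw [h, ENNReal.ofReal_mul (centredPDF_nonneg _ _)]
  rw [lintegral_const_mul, lintegral_centredPDF_shift (by positivity), mul_one]
  exact (measurable_centredPDF_comp measurable_const (by fun_prop)).ennreal_ofReal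

theorem normalDensity_hyperCov {k : ℕ} (H : O k) {d : Fin k → ℝ} (hd : ∀ i, 0 < d i) (μ y : E k) :
    normalDensity μ (hyperCov H d) y = ∏ j, centredPDF (d j) (H.1.mulVec (y - μ).ofLp j) := by
  simp_rw [centredPDF_eq (hd _)]
  rw [normalDensity, hyperCov_inv H hd, dotProduct_hyperCov_mulVec, det_hyperCov,
    Finset.prod_mul_distrib, Finset.prod_mul_distrib, ← Real.exp_sum, Finset.prod_const,
    Real.finsetProd_rpow _ _ fun i _ => (hd i).le]
  congr 1
  · congr 1
    rw [Finset.card_univ, Fintype.card_fin, Real.sqrt_eq_rpow, ← Real.rpow_neg (by positivity),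
      ← Real.rpow_mul_natCast (by positivity)]
    congr 1
    ring
  · congr 1
    rw [Finset.mul_sum]
    refine Finset.sum_congr rfl fun j _ => ?_
    have := (hd j).ne'
    simp only [Pi.inv_apply]
    field_simp

/-- The standard normal law is rotation invariant, so the same `H` splits both layers of the model.
-/
theorem normalDensity_one {k : ℕ} (H : O k) (μ y : E k) :
    normalDensity μ 1 y = ∏ j, centredPDF 1 (H.1.mulVec (y - μ).ofLp j) := by
  rw [← hyperCov_one H]
  exact normalDensity_hyperCov H (d := 1) (fun _ => one_pos) μ y

theorem measurePreserving_mulVec {k : ℕ} (H : O k) :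
    MeasurePreserving (fun v : Fin k → ℝ => H.1.mulVec v) volume volume := by
  have h1 : H.1.det * H.1.det = 1 := by
    simpa [Matrix.det_transpose] using det_transpose_mul_det H
  have h0 : H.1.det ≠ 0 := fun h => by simp [h] at h1
  have h2 : |(H.1.det)⁻¹| = 1 := by
    rw [abs_inv]
    rcases mul_self_eq_one_iff.1 h1 with h | h <;> simp [h]
  refine ⟨by fun_prop, ?_⟩
  have h := Real.map_matrix_volume_pi_eq_smul_volume_pi h0
  rw [h2, ENNReal.ofReal_one, one_smul] at h
  exact h

/-- Integrating out a location parameter in rotated coordinates. -/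
theorem lintegral_location {k : ℕ} (H : O k) {d : Fin k → ℝ} (hd : ∀ i, 0 < d i) (β x : E k) :
    ∫⁻ t : E k, ENNReal.ofReal ((∏ j, centredPDF 1 (H.1.mulVec (x - t).ofLp j)) *
        ∏ j, centredPDF (d j) (H.1.mulVec (t - β).ofLp j)) =
      ENNReal.ofReal (∏ j, centredPDF (1 + d j) (H.1.mulVec (x - β).ofLp j)) := by
  set y := H.1.mulVec (x - β).ofLp with hy
  set F : Fin k → ℝ → ℝ≥0∞ := fun j s =>
    ENNReal.ofReal (centredPDF 1 (y j - s) * centredPDF (d j) s) with hF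
  have hFm : ∀ j, Measurable (F j) := fun j =>
    ((measurable_centredPDF_comp measurable_const (by fun_prop)).mul
      (measurable_centredPDF_comp measurable_const measurable_id)).ennreal_ofReal
  have hGm : Measurable fun v : Fin k → ℝ => ∏ j, F j (v j) :=
    Finset.measurable_fun_prod _ fun j _ => (hFm j).comp (measurable_pi_apply j)
  have h1 : ∀ t : E k, ENNReal.ofReal ((∏ j, centredPDF 1 (H.1.mulVec (x - t).ofLp j)) *
        ∏ j, centredPDF (d j) (H.1.mulVec (t - β).ofLp j)) =
      ∏ j, F j (H.1.mulVec (t - β).ofLp j) := by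
    intro t
    rw [← Finset.prod_mul_distrib, ENNReal.ofReal_prod_of_nonneg fun j _ =>
      mul_nonneg (centredPDF_nonneg _ _) (centredPDF_nonneg _ _)]
    refine Finset.prod_congr rfl fun j _ => ?_
    have : x - t = (x - β) - (t - β) := by abel
    rw [hF, hy, this, WithLp.ofLp_sub, Matrix.mulVec_sub, Pi.sub_apply]
  simp_rw [h1]
  -- Translation by `β` and then rotation by `H` both preserve Lebesgue measure, leaving a separated
  -- integral.
  rw [lintegral_sub_right_eq_self (fun t : E k => ∏ j, F j (H.1.mulVec t.ofLp j)) β]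
  refine (((measurePreserving_mulVec H).comp
    (PiLp.volume_preserving_ofLp (Fin k))).lintegral_comp hGm).trans ?_
  rw [volume_pi, lintegral_pi_prod _ _ hFm,
    ENNReal.ofReal_prod_of_nonneg fun j _ => centredPDF_nonneg _ _]
  exact Finset.prod_congr rfl fun j _ => lintegral_centredPDF_mul (hd j) _

/-! ### Integrating out the means. -/

theorem measurable_orthogonal_entry {k : ℕ} (i j : Fin k) : Measurable fun H : O k => H.1 i j :=
  Continuous.measurable ((continuous_subtype_val (p := (· ∈ Matrix.orthogonalGroup (Fin k) ℝ))).matrix_elem i j)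

theorem measurable_rotated {α : Type*} [MeasurableSpace α] {k : ℕ} {H : α → O k} {v : α → E k}
    (hH : Measurable H) (hv : Measurable v) (j : Fin k) :
    Measurable fun a => (H a).1.mulVec (v a).ofLp j := by
  simp only [Matrix.mulVec, dotProduct]
  refine Finset.measurable_fun_sum _ fun i _ => ?_
  have h1 := (measurable_orthogonal_entry j i).comp hH
  have h2 : Measurable fun a => (v a).ofLp i := by fun_prop
  exact h1.mul h2

/-- The joint density written in the eigenbasis of the hyper-covariance matrix. -/
noncomputable def rotatedDensity {m k : ℕ} (π : O k × (Fin k → ℝ) → ℝ) (x : Fin m → E k)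
    (q : Param m k) : ℝ :=
  (∏ i, ((∏ j, centredPDF 1 (q.2.2.1.1.mulVec (x i - q.1 i).ofLp j)) *
    ∏ j, centredPDF (q.2.2.2 j) (q.2.2.1.1.mulVec (q.1 i - q.2.1).ofLp j))) * π q.2.2

theorem measurable_rotatedDensity {m k : ℕ} {π : O k × (Fin k → ℝ) → ℝ} (hπ : Measurable π)
    (x : Fin m → E k) : Measurable (rotatedDensity π x) := by
  have hH : Measurable fun q : Param m k => q.2.2.1 := by fun_prop
  refine Measurable.mul (Finset.measurable_fun_prod _ fun i _ => Measurable.mul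
    (Finset.measurable_fun_prod _ fun j _ => ?_) (Finset.measurable_fun_prod _ fun j _ => ?_))
    (by fun_prop)
  · exact measurable_centredPDF_comp measurable_const (measurable_rotated hH (by fun_prop) j)
  · exact measurable_centredPDF_comp (by fun_prop) (measurable_rotated hH (by fun_prop) j)

/-- The rotated form contains no matrix inverse or determinant, so its measurability, needed for
Tonelli, is immediate. Agreement on `spectra k` suffices, the reference measure being concentrated
there. -/
theorem jointDensity_eq_rotatedDensity {m k : ℕ} (π : O k × (Fin k → ℝ) → ℝ) (x : Fin m → E k)
    {q : Param m k} (hq : q.2.2.2 ∈ spectra k) : jointDensity π x q = rotatedDensity π x q := by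
  rw [jointDensity, rotatedDensity, Finset.prod_mul_distrib]
  simp_rw [normalDensity_hyperCov q.2.2.1 hq.2, normalDensity_one q.2.2.1]

/-- The density of the data given `(β, H, D)`, in the eigenbasis of the covariance matrix. -/
noncomputable def likelihood {m k : ℕ} (x : Fin m → E k) (p : E k × O k × (Fin k → ℝ)) : ℝ :=
  ∏ i, ∏ j, centredPDF (1 + p.2.2 j) (p.2.1.1.mulVec (x i - p.1).ofLp j)

theorem likelihood_nonneg {m k : ℕ} (x : Fin m → E k) (p : E k × O k × (Fin k → ℝ)) :
    0 ≤ likelihood x p :=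
  Finset.prod_nonneg fun _ _ => Finset.prod_nonneg fun _ _ => centredPDF_nonneg _ _

theorem lintegral_rotatedDensity {m k : ℕ} (π : O k × (Fin k → ℝ) → ℝ) (x : Fin m → E k)
    {p : E k × O k × (Fin k → ℝ)} (hp : p.2.2 ∈ spectra k) :
    ∫⁻ θ : Fin m → E k, ENNReal.ofReal (rotatedDensity π x (θ, p)) =
      ENNReal.ofReal (likelihood x p * π p.2) := by
  set F : Fin m → E k → ℝ≥0∞ := fun i t =>
    ENNReal.ofReal ((∏ j, centredPDF 1 (p.2.1.1.mulVec (x i - t).ofLp j)) *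
      ∏ j, centredPDF (p.2.2 j) (p.2.1.1.mulVec (t - p.1).ofLp j)) with hF
  have hFm : ∀ i, Measurable (F i) := fun i => by
    refine (Measurable.mul (Finset.measurable_fun_prod _ fun j _ => ?_)
      (Finset.measurable_fun_prod _ fun j _ => ?_)).ennreal_ofReal
    · exact measurable_centredPDF_comp measurable_const
        (measurable_rotated measurable_const (by fun_prop) j)
    · exact measurable_centredPDF_comp measurable_const
        (measurable_rotated measurable_const (by fun_prop) j)
  have h1 : ∀ θ : Fin m → E k, ENNReal.ofReal (rotatedDensity π x (θ, p)) =
      (∏ i, F i (θ i)) * ENNReal.ofReal (π p.2) := by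
    intro θ
    have h0 : ∀ i, 0 ≤ (∏ j, centredPDF 1 (p.2.1.1.mulVec (x i - θ i).ofLp j)) *
        ∏ j, centredPDF (p.2.2 j) (p.2.1.1.mulVec (θ i - p.1).ofLp j) := fun i =>
      mul_nonneg (Finset.prod_nonneg fun _ _ => centredPDF_nonneg _ _)
        (Finset.prod_nonneg fun _ _ => centredPDF_nonneg _ _)
    rw [rotatedDensity, ENNReal.ofReal_mul (Finset.prod_nonneg fun i _ => h0 i),
      ENNReal.ofReal_prod_of_nonneg fun i _ => h0 i]
  have hPm : Measurable fun θ : Fin m → E k => ∏ i, F i (θ i) :=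
    Finset.measurable_fun_prod _ fun i _ => (hFm i).comp (measurable_pi_apply i)
  simp_rw [h1]
  rw [lintegral_mul_const _ hPm, volume_pi, lintegral_pi_prod _ _ hFm,
    ENNReal.ofReal_mul (likelihood_nonneg x p), likelihood,
    ENNReal.ofReal_prod_of_nonneg fun _ _ => Finset.prod_nonneg fun _ _ => centredPDF_nonneg _ _]
  congr 1
  exact Finset.prod_congr rfl fun i _ => lintegral_location p.2.1 hp.2 p.1 (x i)

theorem ae_mem_spectra {k : ℕ} {α : Type*} [MeasurableSpace α] (μ : Measure α) :
    ∀ᵐ q ∂(μ.prod (volume.restrict (spectra k))), q.2 ∈ spectra k :=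
  Measure.quasiMeasurePreserving_snd.ae (ae_restrict_mem (measurableSet_spectra k))

/-- Integrating out `θ` in the marginal density. -/
theorem marginalDensity_eq {m k : ℕ} (A : Matrix (Fin k) (Fin k) ℝ) (ν : Measure (O k))
    [SFinite ν] {π : O k × (Fin k → ℝ) → ℝ} (hπ : Measurable π) (x : Fin m → E k) :
    marginalDensity A ν π x = ∫⁻ p, ENNReal.ofReal (likelihood x p * π p.2)
      ∂((multivariateGaussian 0 A).prod (ν.prod (volume.restrict (spectra k)))) := by
  have hae : ∀ᵐ p ∂((multivariateGaussian 0 A).prod (ν.prod (volume.restrict (spectra k)))),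
      p.2.2 ∈ spectra k := Measure.quasiMeasurePreserving_snd.ae (ae_mem_spectra ν)
  have hae' : ∀ᵐ q ∂(baseMeasure m A ν), q.2.2.2 ∈ spectra k :=
    Measure.quasiMeasurePreserving_snd.ae hae
  rw [marginalDensity, lintegral_congr_ae (g := fun q => ENNReal.ofReal (rotatedDensity π x q))
      (hae'.mono fun q hq => congrArg _ (jointDensity_eq_rotatedDensity π x hq)), baseMeasure,
    lintegral_prod_symm _ (measurable_rotatedDensity hπ x).ennreal_ofReal.aemeasurable]
  exact lintegral_congr_ae (hae.mono fun p hp => lintegral_rotatedDensity π x hp)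

/-! ### Two-sided bounds for the likelihood and the marginal density. -/

theorem prod_const_mul_rpow {m k : ℕ} (c : ℝ) {d : Fin k → ℝ} (hd : ∀ i, 0 < d i) :
    ∏ _i : Fin m, ∏ j, c * (1 + d j) ^ (-(1 / 2) : ℝ) =
      c ^ (k * m) * ∏ j, (1 + d j) ^ (-((m : ℝ) / 2)) := by
  rw [Finset.prod_const, Finset.prod_mul_distrib, Finset.prod_const, mul_pow, ← pow_mul,
    ← Finset.prod_pow, Finset.card_univ, Finset.card_univ, Fintype.card_fin, Fintype.card_fin]
  congr 1
  refine Finset.prod_congr rfl fun j _ => ?_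
  rw [← Real.rpow_mul_natCast (by linarith [hd j])]
  congr 1
  ring

/-- The exponential factors are at most 1; only the normalising constants remain. -/
theorem likelihood_le {m k : ℕ} (x : Fin m → E k) {p : E k × O k × (Fin k → ℝ)}
    (hp : ∀ j, 0 < p.2.2 j) :
    likelihood x p ≤ (√(2 * Real.pi))⁻¹ ^ (k * m) * ∏ j, (1 + p.2.2 j) ^ (-((m : ℝ) / 2)) := by
  rw [← prod_const_mul_rpow _ hp]
  refine Finset.prod_le_prod (fun _ _ => Finset.prod_nonneg fun _ _ => centredPDF_nonneg _ _)
    fun i _ => Finset.prod_le_prod (fun _ _ => centredPDF_nonneg _ _) fun j _ => ?_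
  have h : 0 < 1 + p.2.2 j := by linarith [hp j]
  rw [centredPDF_eq h]
  refine mul_le_of_le_one_right (by positivity) (Real.exp_le_one_iff.2 ?_)
  exact div_nonpos_of_nonpos_of_nonneg (neg_nonpos.2 (sq_nonneg _)) (by positivity)

/-- Variances 1 + d_j ≥ 1 can only weaken the exponential decay, so replacing them by 1 in the
exponent gives a lower bound, and orthogonality then turns the exponent into one without `H`. -/
theorem le_likelihood {m k : ℕ} (x : Fin m → E k) {p : E k × O k × (Fin k → ℝ)}
    (hp : ∀ j, 0 < p.2.2 j) :
    (√(2 * Real.pi))⁻¹ ^ (k * m) * (∏ j, (1 + p.2.2 j) ^ (-((m : ℝ) / 2))) *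
      Real.exp (-(1 / 2) * ∑ i, ∑ j, (x i - p.1).ofLp j ^ 2) ≤ likelihood x p := by
  have hexp : Real.exp (-(1 / 2) * ∑ i, ∑ j, (x i - p.1).ofLp j ^ 2) =
      ∏ i, ∏ j, Real.exp (-(1 / 2) * p.2.1.1.mulVec (x i - p.1).ofLp j ^ 2) := by
    simp_rw [← Real.exp_sum, ← Finset.mul_sum, sum_sq_mulVec]
  rw [← prod_const_mul_rpow _ hp, hexp, ← Finset.prod_mul_distrib]
  simp_rw [← Finset.prod_mul_distrib]
  have hpos : ∀ j, 0 < 1 + p.2.2 j := fun j => by linarith [hp j]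
  have h0 : ∀ i j, 0 ≤ (√(2 * Real.pi))⁻¹ * (1 + p.2.2 j) ^ (-(1 / 2) : ℝ) *
      Real.exp (-(1 / 2) * p.2.1.1.mulVec (x i - p.1).ofLp j ^ 2) := fun i j => by
    have := hpos j
    positivity
  refine Finset.prod_le_prod (fun i _ => Finset.prod_nonneg fun j _ => h0 i j)
    fun i _ => Finset.prod_le_prod (fun j _ => h0 i j) fun j _ => ?_
  have h := hpos j
  rw [centredPDF_eq h]
  refine mul_le_mul_of_nonneg_left (Real.exp_le_exp.2 ?_) (by positivity)
  rw [neg_div, neg_mul, neg_le_neg_iff, div_le_iff₀ (by positivity)]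
  nlinarith [sq_nonneg (p.2.1.1.mulVec (x i - p.1).ofLp j), hp j]

section Bounds

variable {m k : ℕ} {A : Matrix (Fin k) (Fin k) ℝ} {ν : Measure (O k)} [IsFiniteMeasure ν]
  {π : O k × (Fin k → ℝ) → ℝ} {a₁ a₂ l C : ℝ} (x : Fin m → E k)

/-- Both likelihood bounds are a function of `β` times a function of `D`, so the three integrations
decouple and `H` contributes its total mass. -/
theorem lintegral_mul_profile (f : E k → ℝ≥0∞) (hf : Measurable f) :
    ∫⁻ p, f p.1 * ENNReal.ofReal (profile a₁ a₂ l (m / 2) p.2.2)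
      ∂((multivariateGaussian 0 A).prod (ν.prod (volume.restrict (spectra k)))) =
    (∫⁻ β, f β ∂(multivariateGaussian 0 A)) *
      (ν Set.univ * ∫⁻ d in spectra k, ENNReal.ofReal (profile a₁ a₂ l (m / 2) d)) := by
  have hm := (measurable_profile (k := k) a₁ a₂ l (m / 2)).ennreal_ofReal
  rw [lintegral_prod_mul (g := fun q : O k × (Fin k → ℝ) =>
    ENNReal.ofReal (profile a₁ a₂ l (m / 2) q.2)) hf.aemeasurable
    (hm.comp measurable_snd).aemeasurable]
  congr 1
  have := lintegral_prod_mul (μ := ν) (ν := volume.restrict (spectra k)) (f := fun _ => 1)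
    aemeasurable_const hm.aemeasurable
  simpa using this

theorem marginalDensity_le (hπ : Measurable π) (hC : 0 ≤ C)
    (h : ∀ H, ∀ d ∈ spectra k, π (H, d) ≤ C * referenceDensity a₁ a₂ l d) :
    marginalDensity A ν π x ≤ ENNReal.ofReal (C * (√(2 * Real.pi))⁻¹ ^ (k * m)) *
      (ν Set.univ * ∫⁻ d in spectra k, ENNReal.ofReal (profile a₁ a₂ l (m / 2) d)) := by
  have key := lintegral_mul_profile (m := m) (A := A) (ν := ν) (a₁ := a₁) (a₂ := a₂) (l := l)
    (fun _ => ENNReal.ofReal (C * (√(2 * Real.pi))⁻¹ ^ (k * m))) measurable_const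
  rw [lintegral_const, measure_univ, mul_one] at key
  rw [marginalDensity_eq A ν hπ, ← key]
  refine lintegral_mono_ae ((Measure.quasiMeasurePreserving_snd.ae (ae_mem_spectra ν)).mono
    fun p hp => ?_)
  rw [← ENNReal.ofReal_mul (by positivity)]
  refine ENNReal.ofReal_le_ofReal ?_
  have hr := referenceDensity_nonneg a₁ a₂ l hp
  calc likelihood x p * π p.2 ≤ likelihood x p * (C * referenceDensity a₁ a₂ l p.2.2) :=
        mul_le_mul_of_nonneg_left (h _ _ hp) (likelihood_nonneg x p)
    _ ≤ ((√(2 * Real.pi))⁻¹ ^ (k * m) * ∏ j, (1 + p.2.2 j) ^ (-((m : ℝ) / 2))) *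
          (C * referenceDensity a₁ a₂ l p.2.2) :=
        mul_le_mul_of_nonneg_right (likelihood_le x hp.2) (by positivity)
    _ = _ := by
        rw [profile]
        ring

theorem le_marginalDensity (hπ : Measurable π) (hC : 0 ≤ C)
    (h : ∀ H, ∀ d ∈ spectra k, C * referenceDensity a₁ a₂ l d ≤ π (H, d)) :
    (∫⁻ β, ENNReal.ofReal (C * (√(2 * Real.pi))⁻¹ ^ (k * m) *
        Real.exp (-(1 / 2) * ∑ i, ∑ j, (x i - β).ofLp j ^ 2)) ∂(multivariateGaussian 0 A)) *
      (ν Set.univ * ∫⁻ d in spectra k, ENNReal.ofReal (profile a₁ a₂ l (m / 2) d)) ≤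
      marginalDensity A ν π x := by
  rw [marginalDensity_eq A ν hπ, ← lintegral_mul_profile _ (by fun_prop)]
  refine lintegral_mono_ae ((Measure.quasiMeasurePreserving_snd.ae (ae_mem_spectra ν)).mono
    fun p hp => ?_)
  rw [← ENNReal.ofReal_mul (by positivity)]
  refine ENNReal.ofReal_le_ofReal ?_
  have hr := referenceDensity_nonneg a₁ a₂ l hp
  calc _ = ((√(2 * Real.pi))⁻¹ ^ (k * m) * (∏ j, (1 + p.2.2 j) ^ (-((m : ℝ) / 2))) *
          Real.exp (-(1 / 2) * ∑ i, ∑ j, (x i - p.1).ofLp j ^ 2)) *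
          (C * referenceDensity a₁ a₂ l p.2.2) := by
        rw [profile]
        ring
    _ ≤ likelihood x p * (C * referenceDensity a₁ a₂ l p.2.2) :=
        mul_le_mul_of_nonneg_right (le_likelihood x hp.2) (by positivity)
    _ ≤ likelihood x p * π p.2 :=
        mul_le_mul_of_nonneg_left (h _ _ hp) (likelihood_nonneg x p)

end Bounds

end HierNormal

/-! ### The properness criterion. -/

open HierNormal in
theorem theorem2p7 {k m : ℕ} (hk : 2 ≤ k) (hm : 1 ≤ m)
    (A : Matrix (Fin k) (Fin k) ℝ) (hA : A.PosSemidef)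
    (ν : MeasureTheory.Measure (O k)) [ν.IsHaarMeasure]
    (a₁ a₂ l : ℝ) (hl₀ : 0 ≤ l) (hl₁ : l ≤ 1)
    (π : O k × (Fin k → ℝ) → ℝ) (hπ : Measurable π) (hcond : Condition1 a₁ a₂ l π)
    (x : Fin m → E k) :
    PosteriorProper A ν π x ↔ a₁ < 1 ∧ a₂ > 1 - (m : ℝ) / 2 + ((k : ℝ) - 1) * l := by
  -- With k = n + 1 the exponent k - 1 of the top eigenvalue becomes the natural number n.
  obtain ⟨n, rfl⟩ : ∃ n, k = n + 1 := ⟨k - 1, by omega⟩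
  have := compactSpace_orthogonalGroup (n + 1)
  obtain ⟨C₁, C₂, hC₁, hC₂, hb⟩ := hcond
  have upper := marginalDensity_le (A := A) (ν := ν) x hπ hC₂.le fun H d hd => (hb H d hd).2
  have lower := le_marginalDensity (A := A) (ν := ν) x hπ hC₁.le fun H d hd => (hb H d hd).1
  have hν0 : ν Set.univ ≠ 0 := (isOpen_univ.measure_pos ν Set.univ_nonempty).ne'
  have hν1 : ν Set.univ ≠ ⊤ := MeasureTheory.measure_ne_top _ _
  -- Since 0 * ∞ = 0 in `ℝ≥0∞`, an infinite eigenvalue integral makes the lower bound infinite only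
  -- if this factor and the Haar mass are nonzero.
  have hc : ∫⁻ β, ENNReal.ofReal (C₁ * (√(2 * Real.pi))⁻¹ ^ ((n + 1) * m) *
      Real.exp (-(1 / 2) * ∑ i, ∑ j, (x i - β).ofLp j ^ 2))
      ∂(ProbabilityTheory.multivariateGaussian 0 A) ≠ 0 := by
    rw [← pos_iff_ne_zero, MeasureTheory.lintegral_pos_iff_support (by fun_prop),
      Set.eq_univ_of_forall (s := Function.support _) fun β => ?_]
    · simp
    · exact (ENNReal.ofReal_pos.2 (by positivity)).ne'
  have hJ := lintegral_profile_pos n (a₁ := a₁) (a₂ := a₂) (c := m / 2) hl₀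
  rw [posteriorProper_iff]
  push_cast
  constructor
  · rintro ⟨-, hfin⟩
    have hJ1 := lt_of_le_of_lt lower hfin
    constructor
    · by_contra! h
      rw [lintegral_profile_eq_top_of_one_le n hl₀ h, ENNReal.mul_top hν0,
        ENNReal.mul_top hc] at hJ1
      exact lt_irrefl _ hJ1
    · by_contra! h
      rw [lintegral_profile_eq_top_of_le n hl₀ (by linarith), ENNReal.mul_top hν0,
        ENNReal.mul_top hc] at hJ1
      exact lt_irrefl _ hJ1
  · rintro ⟨h1, h2⟩
    refine ⟨lt_of_lt_of_le (pos_iff_ne_zero.2 ?_) lower, lt_of_le_of_lt upper ?_⟩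
    · exact mul_ne_zero hc (mul_ne_zero hν0 hJ.ne')
    · exact ENNReal.mul_lt_top ENNReal.ofReal_lt_top (ENNReal.mul_lt_top hν1.lt_top
        (lintegral_profile_lt_top hl₀ h1 (by linarith)))
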